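/- For integers $q_1,\dots,q_n$ let $P(q_1,\dots,q_n)$ be the pretzel link: the link whose standard diagram consists of $n$ columns side by side, the $i$-th of which is a vertical twisted band with $|q_i|$ half-twists (crossings), the direction of the twists being given by the sign of $q_i$; at the top and at the bottom, the right end of each column is joined to the left end of the next one, and the right end of the last column to the left end of the first one. For a knot $K$ let $\Delta_K(t)\in\mathbb Z[t,t^{-1}]$ be its Alexander polynomial, well defined up to multiplication by $\pm t^k$ ($k\in\mathbb Z$), and let $\det(K)=|\Delta_K(-1)|$ be its determinant. Let $K=P(q_1,\dots,q_n)$ be a pretzel knot, that is, a pretzel link with exactly one component. Then $$\det(K)=|\sigma_{n-1}(q_1,\dots,q_n)|,$$ where $\sigma_{n-1}$ is the elementary symmetric polynomial of degree $n-1$ (so that $\sigma_0=1$ if $n=1$). If moreover all $q_i$ are nonzero, then $$\det(K)=\left|q_1q_2\cdots q_n\left(\frac1{q_1}+\frac1{q_2}+\dots+\frac1{q_n}\right)\right|.$$ -/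

import Mathlib

open scoped LaurentPolynomial

/-- A (combinatorial, unoriented) link diagram, given by its planar diagram code: crossings
`X[a, b, c, d]` and joints `P[a, b]` (plain points of the curve) glued along edges.

Every edge `e` has two ends `(e, false)` and `(e, true)`. The four slots `0, 1, 2, 3` of a crossing
are listed counterclockwise around it, and the strand through the slots `0, 2` passes under the
strand through the slots `1, 3`. A joint has the two slots `false, true`, which the curve connects.
The maps `cross` and `joint` tell which end of an edge sits in a slot; every end of an edge sits in
exactly one slot. -/
structure LinkDiagram where
  Edge : Type
  Crossing : Type
  Joint : Type
  cross : Crossing → Fin 4 → Edge × Bool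
  joint : Joint → Bool → Edge × Bool
  bijective_slots : Function.Bijective
    (Sum.elim (fun s : Crossing × Fin 4 => cross s.1 s.2) (fun s : Joint × Bool => joint s.1 s.2))

namespace LinkDiagram

variable (D : LinkDiagram)

/-- Two edges are consecutive on the curve: they are opposite at a crossing, or they meet
at a joint. -/
inductive Consecutive : D.Edge → D.Edge → Prop
  | under (c : D.Crossing) : Consecutive (D.cross c 0).1 (D.cross c 2).1
  | over (c : D.Crossing) : Consecutive (D.cross c 1).1 (D.cross c 3).1
  | joint (j : D.Joint) : Consecutive (D.joint j false).1 (D.joint j true).1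

/-- The components of the link (`Quot` divides by the equivalence relation generated). -/
def Component : Type := Quot D.Consecutive

/-- A diagram is a knot diagram if the link has exactly one component. -/
def IsKnot : Prop := Nat.card D.Component = 1

/-- Two edges are consecutive on the curve, and the curve does not pass under between them. -/
inductive ArcStep : D.Edge → D.Edge → Prop
  | over (c : D.Crossing) : ArcStep (D.cross c 1).1 (D.cross c 3).1
  | joint (j : D.Joint) : ArcStep (D.joint j false).1 (D.joint j true).1

/-- The arcs of the diagram: the maximal pieces of the curve without an undercrossing. -/
def Arc : Type := Quot D.ArcStep

/-- The arc that occupies the slot `k` of the crossing `c`. -/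
def arcAt (c : D.Crossing) (k : Fin 4) : D.Arc := Quot.mk _ (D.cross c k).1

/-- An orientation of the link. The edge `e` is directed towards its end `(e, head e)`, so that the
edge whose end `(e, b)` sits in a slot enters the crossing (or the joint) there exactly if
`head e = b`. On each strand through a crossing or a joint, one edge enters and one leaves. -/
structure Orientation where
  head : D.Edge → Bool
  head_cross : ∀ (c : D.Crossing) (k : Fin 4),
    head (D.cross c k).1 = (D.cross c k).2 ↔ ¬ head (D.cross c (k + 2)).1 = (D.cross c (k + 2)).2
  head_joint : ∀ j : D.Joint,
    head (D.joint j false).1 = (D.joint j false).2 ↔ ¬ head (D.joint j true).1 = (D.joint j true).2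

variable {D}

/-- The overstrand runs from slot `1` to slot `3`, so that slot `0` is on its left and slot `2` on
its right. (Otherwise it runs from slot `3` to slot `1`, with slot `2` on its left.) -/
def Orientation.OverForward (o : D.Orientation) (c : D.Crossing) : Prop :=
  o.head (D.cross c 1).1 = (D.cross c 1).2

open Classical in
/-- The under-arc on the left of the overstrand at `c`. -/
noncomputable def Orientation.leftArc (o : D.Orientation) (c : D.Crossing) : D.Arc :=
  if o.OverForward c then D.arcAt c 0 else D.arcAt c 2

open Classical in
/-- The under-arc on the right of the overstrand at `c`. -/
noncomputable def Orientation.rightArc (o : D.Orientation) (c : D.Crossing) : D.Arc :=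
  if o.OverForward c then D.arcAt c 2 else D.arcAt c 0

open Classical in
/-- The Alexander matrix of an oriented diagram over `ℤ[t, t⁻¹]`: one variable for each arc, and
for each crossing with overstrand `x`, under-arc `y` on the left and `z` on the right of it the
relation `(1 - t) x + t y - z = 0`. Arcs may coincide; their coefficients are then added. -/
noncomputable def Orientation.alexanderMatrix (o : D.Orientation) :
    Matrix D.Crossing D.Arc ℤ[T;T⁻¹] :=
  Matrix.of fun c a =>
    (if a = D.arcAt c 1 then 1 - LaurentPolynomial.T 1 else 0)
      + (if a = o.leftArc c then LaurentPolynomial.T 1 else 0)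
      - (if a = o.rightArc c then 1 else 0)

/-- Equality of Laurent polynomials up to multiplication by `± t ^ k`. -/
def DotEq (f g : ℤ[T;T⁻¹]) : Prop :=
  ∃ k : ℤ, f = LaurentPolynomial.T k * g ∨ f = -(LaurentPolynomial.T k * g)

variable (D)

/-- `Δ` is an Alexander polynomial of the knot with diagram `D`: up to `± t ^ k` it is a minor of
order `#arcs - 1` of the Alexander matrix, for some orientation. A knot diagram with at least one
crossing has as many arcs as crossings, so these minors arise by deleting one row and one column;
for the diagram of the unknot without crossings the only one is the empty minor, `1`. -/
def IsAlexanderPolynomial (Δ : ℤ[T;T⁻¹]) : Prop :=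
  ∃ (o : D.Orientation) (r : Fin (Nat.card D.Arc - 1) ↪ D.Crossing)
    (s : Fin (Nat.card D.Arc - 1) ↪ D.Arc),
    DotEq Δ (o.alexanderMatrix.submatrix r s).det

/-- `d` is the determinant of the knot with diagram `D`: `d = |Δ(-1)|` for an Alexander
polynomial `Δ`. -/
def IsDeterminant (d : ℤ) : Prop :=
  ∃ Δ : ℤ[T;T⁻¹], D.IsAlexanderPolynomial Δ ∧
    d = |LaurentPolynomial.eval₂ (RingHom.id ℤ) (-1 : ℤˣ) Δ|

end LinkDiagram

namespace Pretzel

variable {n : ℕ} (q : Fin n → ℤ)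

/-- The crossings: `|q i|` of them in the `i`-th column, numbered from top to bottom. -/
abbrev Crossing : Type := Σ i : Fin n, Fin (q i).natAbs

/-- The edges: in the `i`-th column there are `|q i| + 1` levels (above, between and below the
crossings) with two edges each, the left one (`false`) and the right one (`true`). -/
abbrev Edge : Type := (Σ i : Fin n, Fin ((q i).natAbs + 1)) × Bool

/-- The joints: `(false, i)` is the cap that connects the top right of the `i`-th column with the
top left of the next one, and `(true, i)` is the cup that does the same at the bottom. The column
after the last one is the first one. -/
abbrev Joint (n : ℕ) : Type := Bool × Fin n

/-- The end of an edge at a crossing, on its left or right side (`right`), in the north or south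
(`south`). The end `(e, false)` is the upper end of the edge `e`, and `(e, true)` the lower end. -/
def corner (c : Crossing q) (south right : Bool) : Edge q × Bool :=
  if south then ((⟨c.1, c.2.succ⟩, right), false) else ((⟨c.1, c.2.castSucc⟩, right), true)

/-- The corners in counterclockwise order, starting with one of the understrand. In columns with
`q i > 0` the strand from north-west to south-east is over (the order is SW, SE, NE, NW), in
columns with `q i < 0` the strand from north-east to south-west (the order is NW, SW, SE, NE). -/
def cross (c : Crossing q) : Fin 4 → Edge q × Bool :=
  if 0 < q c.1 then
    ![corner q c true false, corner q c true true, corner q c false true, corner q c false false]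
  else
    ![corner q c false false, corner q c true false, corner q c true true, corner q c false true]

/-- The ends of edges at a cap (upper ends on the top level) or a cup (lower ends on the bottom
level). -/
def joint (j : Joint n) (b : Bool) : Edge q × Bool :=
  let i : Fin n := if b then finRotate n j.2 else j.2
  ((⟨i, if j.1 then Fin.last _ else 0⟩, !b), j.1)

theorem bijective_slots : Function.Bijective
    (Sum.elim (fun s : Crossing q × Fin 4 => cross q s.1 s.2)
      (fun s : Joint n × Bool => joint q s.1 s.2)) := by
  have hcor : ∀ c : Crossing q, ∃ f : Fin 4 → Bool × Bool, Function.Bijective f ∧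
      ∀ m, cross q c m = corner q c (f m).1 (f m).2 := by
    intro c
    by_cases h : 0 < q c.1
    · refine ⟨![(true, false), (true, true), (false, true), (false, false)], by decide, ?_⟩
      intro m
      fin_cases m <;> simp [cross, h]
    · refine ⟨![(false, false), (true, false), (true, true), (false, true)], by decide, ?_⟩
      intro m
      fin_cases m <;> simp [cross, h]
  have hne : ∀ (c : Crossing q) (m : Fin 4) (j : Joint n) (b : Bool),
      cross q c m ≠ joint q j b := by
    rintro ⟨i, k⟩ m ⟨u, i'⟩ b h
    have hP : ((joint q (u, i') b).2 = false ∧ ((joint q (u, i') b).1.1.2 : ℕ) = 0) ∨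
        ((joint q (u, i') b).2 = true ∧
          ((joint q (u, i') b).1.1.2 : ℕ) = (q (joint q (u, i') b).1.1.1).natAbs) := by
      cases u <;> simp [joint]
    obtain ⟨f, -, hm⟩ := hcor ⟨i, k⟩
    rw [← h, hm] at hP
    have hk := k.isLt
    generalize f m = p at hP
    rcases p with ⟨s, r⟩
    cases s <;> simp [corner] at hP
    omega
  have hcinj : ∀ (c c' : Crossing q) (s s' r r' : Bool),
      corner q c s r = corner q c' s' r' → c = c' ∧ s = s' ∧ r = r' := by
    rintro ⟨i, k⟩ ⟨i', k'⟩ s s' r r' h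
    have hi : i = i' := by
      have := congrArg (fun x => x.1.1.1) h
      cases s <;> cases s' <;> simpa [corner] using this
    subst hi
    cases s <;> cases s' <;> simp_all [corner]
  constructor
  · rintro (⟨c, m⟩ | ⟨⟨u, i⟩, b⟩) (⟨c', m'⟩ | ⟨⟨u', i'⟩, b'⟩) h
    · simp only [Sum.elim_inl] at h
      obtain ⟨f, hf, hm⟩ := hcor c
      obtain ⟨f', -, hm'⟩ := hcor c'
      obtain rfl : c = c' := by
        rw [hm, hm'] at h
        exact (hcinj _ _ _ _ _ _ h).1
      rw [hm, hm] at h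
      rw [hf.1 (Prod.ext (hcinj _ _ _ _ _ _ h).2.1 (hcinj _ _ _ _ _ _ h).2.2)]
    · exact absurd h (hne _ _ _ _)
    · exact absurd h.symm (hne _ _ _ _)
    · simp only [Sum.elim_inr] at h
      have hu : u = u' := congrArg (fun x => x.2) h
      have hb : (!b) = !b' := congrArg (fun x => x.1.2) h
      have hi : (if b then finRotate n i else i) = if b' then finRotate n i' else i' :=
        congrArg (fun x => x.1.1.1) h
      obtain rfl : b = b' := by simpa using hb
      subst hu
      cases b <;> simp at hi <;> rw [hi]
  · have hc : ∀ (c : Crossing q) (s r : Bool), ∃ m, cross q c m = corner q c s r := by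
      intro c s r
      obtain ⟨f, hf, hm⟩ := hcor c
      obtain ⟨m, h⟩ := hf.2 (s, r)
      exact ⟨m, by rw [hm, h]⟩
    rintro ⟨⟨⟨i, k⟩, r⟩, b⟩
    cases b
    · induction k using Fin.cases with
      | zero =>
        cases r
        · obtain ⟨j, rfl⟩ := (finRotate n).surjective i
          exact ⟨Sum.inr ((false, j), true), rfl⟩
        · exact ⟨Sum.inr ((false, i), false), by simp [joint]⟩
      | succ k =>
        obtain ⟨m, hm⟩ := hc ⟨i, k⟩ true r
        exact ⟨Sum.inl (⟨i, k⟩, m), by simp [hm, corner]⟩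
    · induction k using Fin.lastCases with
      | last =>
        cases r
        · obtain ⟨j, rfl⟩ := (finRotate n).surjective i
          exact ⟨Sum.inr ((true, j), true), rfl⟩
        · exact ⟨Sum.inr ((true, i), false), by simp [joint]⟩
      | cast k =>
        obtain ⟨m, hm⟩ := hc ⟨i, k⟩ false r
        exact ⟨Sum.inl (⟨i, k⟩, m), by simp [hm, corner]⟩

end Pretzel

/-- The standard diagram of the pretzel link `P(q₁, …, qₙ)`: `n` columns side by side, the `i`-th
one with `|q i|` half-twists whose direction is given by the sign of `q i`; neighbouring columns are
connected at the top and at the bottom, and the last column is connected with the first. -/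
def pretzel {n : ℕ} (q : Fin n → ℤ) : LinkDiagram where
  Edge := Pretzel.Edge q
  Crossing := Pretzel.Crossing q
  Joint := Pretzel.Joint n
  cross := Pretzel.cross q
  joint := Pretzel.joint q
  bijective_slots := Pretzel.bijective_slots q

/-!
At `t = -1` the relation `(1 - t) x + t y - z = 0` of a crossing becomes `2 x = y + z`, up to sign,
whatever the orientation. The determinant is therefore the absolute value of a minor of the
*colouring matrix*, and that minor is, up to sign, the order of the abelian group with one generator
for each arc, subject to the relations `2 x = y + z` and to one arc being zero
(`Matrix.RowQuotient.card_eq_natAbs_det`; zero stands for an infinite order). Two points are needed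
for all the minors to present this same group. There are at most as many crossings as arcs (`LinkDiagram.card_crossing_le_card_arc`),
so that a minor, which leaves out one arc, leaves out at most one crossing; and the relation of a
crossing left out follows from the others (`Pretzel.defect_eq_zero_of_subsingleton`).

For the second point, and for the computation of the group, consider the gap `left - right` between
the two colours on a level of a column. The relation of a crossing says exactly that the gap does
not change there (`Pretzel.sign_smul_defect`). The gaps at the top of the columns add up to zero,
because the right end of each column is the left end of the next one, and so do those at the bottom;
if the gap is constant at all crossings but one, it is constant there as well. So each column has
one gap `yᵢ`; all colours in it arise from those at the top by adding multiples of `yᵢ`, from top to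
bottom `qᵢ yᵢ`. The cups at the bottom then say that all `qᵢ yᵢ` are equal. Thus the group is
generated by `y₁, …, yₙ` and `l` with the relations `qᵢ yᵢ = l` and `y₁ + ⋯ + yₙ = 0`
(`Pretzel.nonempty_rowQuotient_equiv`), and its order is the absolute value of the determinant of
the diagonal matrix of the `qᵢ`, bordered by ones and minus ones, which is `σₙ₋₁`
(`Matrix.det_bordered_diagonal`).

An Alexander polynomial exists because any diagram has an orientation
(`LinkDiagram.exists_orientation`) and a knot diagram has at most one arc more than crossings
(`LinkDiagram.IsKnot.card_arc_le`). This last bound is where it matters that the link is a knot.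
-/

/-! ### Abelian groups presented by integer matrices -/

namespace Matrix

/-- The abelian group with one generator for each column and one relation for each row. -/
abbrev RowQuotient {ι κ : Type*} [Fintype ι] (N : Matrix ι κ ℤ) : Type _ :=
  (κ → ℤ) ⧸ LinearMap.range N.vecMulLinear

namespace RowQuotient

variable {ι κ V : Type*} [Fintype ι] [Fintype κ] [DecidableEq κ] [AddCommGroup V]
  (N : Matrix ι κ ℤ)

/-- The generator that belongs to a column. -/
def gen (j : κ) : N.RowQuotient := Submodule.Quotient.mk (Pi.single j 1)

theorem mk_eq_sum (x : κ → ℤ) :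
    (Submodule.Quotient.mk x : N.RowQuotient) = ∑ j, x j • gen N j := by
  conv_lhs => rw [pi_eq_sum_univ' x]
  rw [← Submodule.mkQ_apply, map_sum]
  refine Finset.sum_congr rfl fun j _ => ?_
  rw [map_smul]
  rfl

theorem sum_row_smul_gen (i : ι) : ∑ j, N i j • gen N j = 0 := by
  classical
  rw [← mk_eq_sum N (fun j => N i j), Submodule.Quotient.mk_eq_zero]
  exact ⟨Pi.single i 1, by ext j; simp [Matrix.row]⟩

variable {N}

theorem hom_ext {f g : N.RowQuotient →ₗ[ℤ] V} (h : ∀ j, f (gen N j) = g (gen N j)) : f = g := by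
  ext j
  exact h j

/-- The homomorphism with prescribed values on the generators. -/
noncomputable def lift (v : κ → V) (h : ∀ i, ∑ j, N i j • v j = 0) : N.RowQuotient →ₗ[ℤ] V :=
  Submodule.liftQ _ (Fintype.linearCombination ℤ v) <| by
    classical
    rw [LinearMap.range_le_ker_iff]
    ext i
    simpa [Fintype.linearCombination_apply, Matrix.row] using h i

@[simp]
theorem lift_gen (v : κ → V) (h : ∀ i, ∑ j, N i j • v j = 0) (j : κ) :
    lift v h (gen N j) = v j := by
  simp [lift, gen, Fintype.linearCombination_apply_single]

/-- The order of the group is the absolute value of the determinant; an infinite group has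
`Nat.card` zero, which matches a vanishing determinant. -/
theorem card_eq_natAbs_det (N : Matrix κ κ ℤ) : Nat.card N.RowQuotient = N.det.natAbs := by
  by_cases hdet : N.det = 0
  · rw [hdet, Int.natAbs_zero]
    by_contra hcard
    have hfin : Finite N.RowQuotient := Nat.finite_of_card_ne_zero hcard
    -- The order `m` kills the group, so `m • 1` factors through `N`.
    set m := Nat.card N.RowQuotient with hm
    have hrow : ∀ j : κ, ∃ y : κ → ℤ, y ᵥ* N = (m : ℤ) • (Pi.single j 1 : κ → ℤ) := by
      intro j
      have h0 : (Submodule.Quotient.mk ((m : ℤ) • (Pi.single j 1 : κ → ℤ)) : N.RowQuotient) = 0 := by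
        rw [Submodule.Quotient.mk_smul, natCast_zsmul, hm]
        exact card_nsmul_eq_zero'
      obtain ⟨y, hy⟩ := (Submodule.Quotient.mk_eq_zero _).1 h0
      exact ⟨y, hy⟩
    choose Y hY using hrow
    have hmul : (Matrix.of Y) * N = (m : ℤ) • (1 : Matrix κ κ ℤ) := by
      ext i j
      have := congrFun (hY i) j
      rw [Matrix.mul_apply]
      simp only [Matrix.vecMul, dotProduct, Pi.smul_apply] at this
      simp only [Matrix.of_apply, this, Matrix.smul_apply, Matrix.one_apply, Pi.single_apply,
        eq_comm]
    have := congrArg Matrix.det hmul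
    rw [Matrix.det_mul, hdet, mul_zero, Matrix.det_smul, Matrix.det_one, mul_one] at this
    exact pow_ne_zero _ (by exact_mod_cast hcard) this.symm
  · have hinj : Function.Injective N.vecMulLinear := by
      intro x y hxy
      rw [← sub_eq_zero]
      refine Matrix.eq_zero_of_vecMul_eq_zero hdet ?_
      rw [Matrix.sub_vecMul, sub_eq_zero]
      exact hxy
    rw [← Submodule.natAbs_det_equiv _ (LinearEquiv.ofInjective N.vecMulLinear hinj),
      ← Matrix.det_transpose, ← LinearMap.det_toLin']
    congr 2
    ext i j
    change N.vecMulLinear (Pi.single i 1) j = _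
    simp

end RowQuotient

/-- The determinant of a diagonal matrix bordered by a row of ones and a column of minus ones. -/
theorem det_bordered_diagonal {R ι : Type*} [CommRing R] [IsDomain R] [Fintype ι] [DecidableEq ι]
    (d : ι → R) :
    (fromBlocks (diagonal d) (of fun _ (_ : Unit) => -1) (of fun _ _ => 1) 0).det
      = ∑ i, ∏ j ∈ Finset.univ.erase i, d j := by
  -- Clearing the last column works over a domain if no `d i` vanishes. The general case is the
  -- specialization to `X = 0` of the case `X + d i` over `R[X]`.
  have key : ∀ {S : Type _} [CommRing S] [IsDomain S] (d : ι → S), (∀ i, d i ≠ 0) →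
      (fromBlocks (diagonal d) (of fun _ (_ : Unit) => -1) (of fun _ _ => 1) 0).det
        = ∑ i, ∏ j ∈ Finset.univ.erase i, d j := by
    intro S _ _ d hd
    have hP : ∏ i, d i ≠ 0 := Finset.prod_ne_zero_iff.2 fun i _ => hd i
    have hmul : fromBlocks (diagonal d) (of fun _ (_ : Unit) => (-1 : S)) (of fun _ _ => 1) 0 *
        fromBlocks 1 (of fun i _ => ∏ j ∈ Finset.univ.erase i, d j) 0
          (diagonal fun _ => ∏ i, d i) =
        fromBlocks (diagonal d) 0 (of fun _ _ => 1)
          (of fun _ _ => ∑ i, ∏ j ∈ Finset.univ.erase i, d j) := by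
      rw [fromBlocks_multiply]
      congr 1
      · simp
      · ext i u
        simp [Matrix.mul_apply, diagonal_apply, Finset.mul_prod_erase]
      · simp
      · ext i u
        simp [Matrix.mul_apply]
    have := congrArg Matrix.det hmul
    rw [det_mul, det_fromBlocks_zero₂₁, det_fromBlocks_zero₁₂, det_one, one_mul, det_diagonal,
      det_diagonal, det_unique (n := Unit), Finset.univ_unique, Finset.prod_singleton, mul_comm] at this
    exact mul_left_cancel₀ hP this
  have h := key (fun i => Polynomial.X + Polynomial.C (d i)) fun i => Polynomial.X_add_C_ne_zero _
  have h' := congrArg (Polynomial.evalRingHom 0) h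
  rw [RingHom.map_det] at h'
  convert h' using 1
  · congr 1
    ext (i | i) (j | j)
    · by_cases hij : i = j <;> simp [hij]
    all_goals simp
  · simp

end Matrix

/-! ### Quotients of finite sets -/

/-- Dividing a finite set by the equivalence relation that `k` pairs generate loses at most `k`
classes: a function on the quotient is a function on the set that satisfies `k` equations. -/
theorem card_le_card_quot_add_card {V ι : Type*} [Finite V] [Finite ι] (r : V → V → Prop)
    (f g : ι → V) (h : ∀ x y, r x y → ∃ i, f i = x ∧ g i = y) :
    Nat.card V ≤ Nat.card (Quot r) + Nat.card ι := by
  classical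
  have := Fintype.ofFinite V
  have := Fintype.ofFinite ι
  have : Finite (Quot r) := Quot.finite r
  have := Fintype.ofFinite (Quot r)
  let φ : (V → ℚ) →ₗ[ℚ] (ι → ℚ) :=
    LinearMap.funLeft ℚ ℚ f - LinearMap.funLeft ℚ ℚ g
  let ψ : (Quot r → ℚ) →ₗ[ℚ] (V → ℚ) := LinearMap.funLeft ℚ ℚ (Quot.mk r)
  have hker : LinearMap.ker φ ≤ LinearMap.range ψ := by
    intro x hx
    have hx' : ∀ i, x (f i) = x (g i) := fun i => by
      have := congrFun (LinearMap.mem_ker.1 hx) i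
      exact sub_eq_zero.1 (by simpa [φ, LinearMap.funLeft_apply] using this)
    refine ⟨Quot.lift x ?_, rfl⟩
    intro a b hab
    obtain ⟨i, rfl, rfl⟩ := h a b hab
    exact hx' i
  have h1 := φ.finrank_range_add_finrank_ker
  have h2 := Submodule.finrank_le (LinearMap.range φ)
  have h3 := Submodule.finrank_mono hker
  have h4 := LinearMap.finrank_range_le ψ
  simp only [Module.finrank_fintype_fun_eq_card, Nat.card_eq_fintype_card] at *
  omega

/-! ### Orientations of link diagrams -/

/-- Two fixed point free involutions admit a function that both of them negate: they generate a
dihedral group whose reflections are conjugate to one of the two, so a reflection preserves no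
orbit of the rotations. -/
theorem exists_bool_not_of_involutive {X : Type*} (α β : Equiv.Perm X)
    (hα : ∀ x, α (α x) = x) (hβ : ∀ x, β (β x) = x) (hα' : ∀ x, α x ≠ x) (hβ' : ∀ x, β x ≠ x) :
    ∃ f : X → Bool, (∀ x, f (α x) = !f x) ∧ ∀ x, f (β x) = !f x := by
  classical
  have hαα : α * α = 1 := Equiv.ext hα
  have hββ : β⁻¹ = β := inv_eq_of_mul_eq_one_left (Equiv.ext hβ)
  set π := α * β with hπ
  have hβπ : ∀ x, β x = α (π x) := fun x => (hα _).symm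
  -- `α` conjugates the rotation `π` to its inverse
  have hconj : ∀ (k : ℤ) x, α ((π ^ k) x) = (π ^ (-k)) (α x) := by
    have hinv : α * π * α⁻¹ = π⁻¹ := by
      rw [hπ, mul_inv_rev, hββ, ← mul_assoc, hαα, one_mul]
    intro k x
    rw [zpow_neg, ← inv_zpow, ← hinv, conj_zpow]
    simp
  have hne : ∀ x, ¬ π.SameCycle x (α x) := by
    rintro x ⟨k, hk⟩
    obtain ⟨m, rfl | rfl⟩ := k.even_or_odd'
    · apply hα' ((π ^ m) x)
      rw [hconj, ← hk, ← Equiv.Perm.mul_apply, ← zpow_add]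
      congr 2
      ring
    · apply hβ' ((π ^ m) x)
      rw [hβπ, ← Equiv.Perm.mul_apply π, ← zpow_one_add, hconj, ← hk, ← Equiv.Perm.mul_apply,
        ← zpow_add]
      congr 2
      ring
  -- `α` and `β` exchange the same two orbits of `π`; a well-ordering selects one of them
  let cl : X → Quotient (Equiv.Perm.SameCycle.setoid π) := Quotient.mk _
  have hcl : ∀ x, cl (α x) ≠ cl x := fun x h => hne x (Quotient.exact h).symm
  have h1 : ∀ x, cl (α (β x)) = cl x := fun x => Quotient.sound ⟨-1, by simp [hπ]⟩
  have h2 : ∀ x, cl (β x) = cl (α x) := fun x => Quotient.sound ⟨1, by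
    have := hconj 1 x
    rw [zpow_one] at this
    rw [hβπ, this, zpow_one, zpow_neg_one, ← Equiv.Perm.mul_apply, mul_inv_cancel,
      Equiv.Perm.one_apply]⟩
  have hflip : ∀ a b : Quotient (Equiv.Perm.SameCycle.setoid π), a ≠ b →
      decide (WellOrderingRel a b) = !decide (WellOrderingRel b a) := by
    intro a b hab
    rcases trichotomous_of WellOrderingRel a b with h | h | h
    · simp [h, asymm_of WellOrderingRel h]
    · exact absurd h hab
    · simp [h, asymm_of WellOrderingRel h]
  refine ⟨fun x => decide (WellOrderingRel (cl x) (cl (α x))), fun x => ?_, fun x => ?_⟩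
  · simp only [hα]
    exact hflip _ _ (hcl x)
  · simp only [h1, h2]
    exact hflip _ _ (hcl x)

namespace LinkDiagram

variable (D : LinkDiagram)

/-- The slots of the crossings and of the joints. -/
abbrev Slot : Type := (D.Crossing × Fin 4) ⊕ (D.Joint × Bool)

/-- The end of an edge that sits in a slot. -/
noncomputable def slotEquiv : D.Slot ≃ D.Edge × Bool := Equiv.ofBijective _ D.bijective_slots

/-- The slot that the curve connects with a given one. -/
def oppositeSlot : Equiv.Perm D.Slot :=
  Equiv.sumCongr ((Equiv.refl _).prodCongr (Equiv.addRight 2))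
    ((Equiv.refl _).prodCongr (Equiv.boolNot))

/-- Every diagram has an orientation: passing to the other end of an edge and passing to the
opposite slot are fixed point free involutions on the ends of edges. -/
theorem exists_orientation : Nonempty D.Orientation := by
  have hfin : ∀ k : Fin 4, k + 2 + 2 = k := by decide
  obtain ⟨f, hf1, hf2⟩ := exists_bool_not_of_involutive
    ((Equiv.refl D.Edge).prodCongr Equiv.boolNot)
    (D.slotEquiv.symm.trans (D.oppositeSlot.trans D.slotEquiv))
    (by rintro ⟨e, b⟩; simp)
    (by
      intro x
      obtain ⟨s, rfl⟩ := D.slotEquiv.surjective x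
      rcases s with ⟨c, k⟩ | ⟨j, b⟩ <;> simp [oppositeSlot, hfin])
    (by rintro ⟨e, b⟩; simp)
    (by
      intro x
      obtain ⟨s, rfl⟩ := D.slotEquiv.surjective x
      rcases s with ⟨c, k⟩ | ⟨j, b⟩
      · simp [oppositeSlot]
      · simp [oppositeSlot])
  -- the value of `f` at an end tells whether the edge is directed towards it
  have hhead : ∀ e : D.Edge × Bool, f (e.1, true) = e.2 ↔ f e = true := by
    rintro ⟨e, b⟩
    cases b
    · have h : f (e, false) = !f (e, true) := hf1 (e, true)
      rw [h]
      simp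
    · rfl
  have hslot : ∀ s, f (D.slotEquiv (D.oppositeSlot s)) = !f (D.slotEquiv s) := fun s => by
    simpa using hf2 (D.slotEquiv s)
  refine ⟨⟨fun e => f (e, true), fun c k => ?_, fun j => ?_⟩⟩
  · rw [hhead, hhead]
    have : f (D.cross c (k + 2)) = !f (D.cross c k) := hslot (Sum.inl (c, k))
    simp [this]
  · rw [hhead, hhead]
    have : f (D.joint j true) = !f (D.joint j false) := hslot (Sum.inr (j, false))
    simp [this]

/-! ### The number of arcs -/

instance [Finite D.Edge] : Finite D.Arc := Quot.finite _

section Finite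

variable [Finite D.Edge] [Finite D.Crossing]

/-- The edges have two ends each, so that `#edges = 2 #crossings + #joints`; and the arcs arise from
the edges by `#crossings + #joints` identifications. -/
theorem card_crossing_le_card_arc [Finite D.Joint] : Nat.card D.Crossing ≤ Nat.card D.Arc := by
  have h := Nat.card_congr D.slotEquiv
  rw [Nat.card_sum, Nat.card_prod, Nat.card_prod, Nat.card_prod, Nat.card_fin,
    Nat.card_eq_fintype_card (α := Bool), Fintype.card_bool] at h
  have h' := card_le_card_quot_add_card D.ArcStep
    (Sum.elim (fun c : D.Crossing => (D.cross c 1).1) fun j : D.Joint => (D.joint j false).1)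
    (Sum.elim (fun c => (D.cross c 3).1) fun j => (D.joint j true).1) (by
      rintro _ _ (c | j)
      · exact ⟨Sum.inl c, rfl, rfl⟩
      · exact ⟨Sum.inr j, rfl, rfl⟩)
  rw [Nat.card_sum] at h'
  change _ ≤ Nat.card D.Arc + _ at h'
  omega

/-- The arcs of a knot become one component when the two under-arcs of every crossing are
joined. -/
theorem IsKnot.card_arc_le (hK : D.IsKnot) : Nat.card D.Arc ≤ Nat.card D.Crossing + 1 := by
  let r : D.Arc → D.Arc → Prop := fun a b => ∃ c, D.arcAt c 0 = a ∧ D.arcAt c 2 = b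
  have h := card_le_card_quot_add_card r (fun c => D.arcAt c 0) (fun c => D.arcAt c 2)
    (fun _ _ h => h)
  let φ : D.Component → Quot r := Quot.lift (fun e => Quot.mk r (Quot.mk D.ArcStep e)) <| by
    rintro _ _ (c | c | j)
    · exact Quot.sound ⟨c, rfl, rfl⟩
    · exact congrArg _ (Quot.sound (ArcStep.over c))
    · exact congrArg _ (Quot.sound (ArcStep.joint j))
  have hφ : Function.Surjective φ := by
    rintro ⟨⟨e⟩⟩
    exact ⟨Quot.mk _ e, rfl⟩
  have : Finite D.Component := Quot.finite _
  have h' := Nat.card_le_card_of_surjective φ hφ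
  have : Nat.card D.Component = 1 := hK
  omega

end Finite

variable {D}

/-! ### Alexander matrices at `t = -1` -/

open Classical in
/-- The Alexander matrix at `t = -1`, which does not depend on an orientation: the crossing with
overstrand `x` and under-arcs `y`, `z` gives the colouring relation `2 x - y - z = 0`. -/
noncomputable def coloringMatrix (D : LinkDiagram) : Matrix D.Crossing D.Arc ℤ :=
  Matrix.of fun c a => (if a = D.arcAt c 1 then 2 else 0) - (if a = D.arcAt c 0 then 1 else 0)
    - (if a = D.arcAt c 2 then 1 else 0)

/-- The failure of the relation `2 x = y + z` at a crossing, for a colouring of the arcs. -/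
def defect {V : Type*} [AddCommGroup V] (col : D.Arc → V) (c : D.Crossing) : V :=
  (2 : ℤ) • col (D.arcAt c 1) - col (D.arcAt c 0) - col (D.arcAt c 2)

theorem sum_coloringMatrix_smul {ι V : Type*} [Fintype ι] [Finite D.Arc] [AddCommGroup V]
    {s : ι → D.Arc} (hs : Function.Injective s) {col : D.Arc → V}
    (hcol : ∀ a ∉ Set.range s, col a = 0) (c : D.Crossing) :
    ∑ j, D.coloringMatrix c (s j) • col (s j) = defect col c := by
  classical
  have := Fintype.ofFinite D.Arc
  rw [Fintype.sum_of_injective s hs _ (fun a => D.coloringMatrix c a • col a)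
    (fun a ha => by rw [hcol a ha, smul_zero]) (fun _ => rfl)]
  simp [coloringMatrix, sub_smul, Finset.sum_sub_distrib, ite_smul, defect]

theorem Orientation.map_alexanderMatrix (o : D.Orientation) :
    o.alexanderMatrix.map (LaurentPolynomial.eval₂ (RingHom.id ℤ) (-1 : ℤˣ))
      = D.coloringMatrix := by
  classical
  ext c a
  by_cases h : o.OverForward c <;>
  simp only [alexanderMatrix, coloringMatrix, leftArc, rightArc, h, Matrix.map_apply,
    Matrix.of_apply, map_sub, map_add, apply_ite (LaurentPolynomial.eval₂ _ _), map_one, map_zero,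
    LaurentPolynomial.eval₂_T, if_true, if_false] <;>
  split_ifs <;> simp

theorem DotEq.abs_eval {f g : ℤ[T;T⁻¹]} (h : DotEq f g) :
    |LaurentPolynomial.eval₂ (RingHom.id ℤ) (-1 : ℤˣ) f|
      = |LaurentPolynomial.eval₂ (RingHom.id ℤ) (-1 : ℤˣ) g| := by
  obtain ⟨k, rfl | rfl⟩ := h <;>
  simp [abs_mul, LaurentPolynomial.eval₂_T, Int.isUnit_iff_abs_eq.1 (Units.isUnit _)]

/-- The determinant is read off from the minors of the colouring matrix. -/
theorem isDeterminant_iff (d : ℤ) : D.IsDeterminant d ↔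
    ∃ (r : Fin (Nat.card D.Arc - 1) ↪ D.Crossing) (s : Fin (Nat.card D.Arc - 1) ↪ D.Arc),
      d = |(D.coloringMatrix.submatrix r s).det| := by
  have key : ∀ (o : D.Orientation) (r : Fin (Nat.card D.Arc - 1) ↪ D.Crossing)
      (s : Fin (Nat.card D.Arc - 1) ↪ D.Arc),
      LaurentPolynomial.eval₂ (RingHom.id ℤ) (-1 : ℤˣ) (o.alexanderMatrix.submatrix r s).det
        = (D.coloringMatrix.submatrix r s).det := by
    intro o r s
    rw [RingHom.map_det, ← o.map_alexanderMatrix]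
    rfl
  constructor
  · rintro ⟨Δ, ⟨o, r, s, h⟩, rfl⟩
    exact ⟨r, s, by rw [h.abs_eval, key]⟩
  · rintro ⟨r, s, rfl⟩
    obtain ⟨o⟩ := D.exists_orientation
    refine ⟨(o.alexanderMatrix.submatrix r s).det, ⟨o, r, s, 0, Or.inl ?_⟩, by rw [key]⟩
    simp

end LinkDiagram

/-! ### Colourings of pretzel diagrams -/

theorem apply_eq_of_finRotate {n : ℕ} {V : Type*} {g : Fin n → V}
    (h : ∀ i, g (finRotate n i) = g i) (i j : Fin n) : g i = g j := by
  obtain _ | n := n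
  · exact i.elim0
  · have h0 : ∀ i, g i = g 0 := by
      intro i
      induction i using Fin.induction with
      | zero => rfl
      | succ i ih => rw [← ih, ← h i.castSucc, finRotate_apply, Fin.coeSucc_eq_succ]
    rw [h0 i, h0 j]

namespace Pretzel

variable {n : ℕ} {q : Fin n → ℤ} {V : Type*} [AddCommGroup V]

/-- The sums `-(y₀ + ⋯ + yᵢ₋₁)`, whose successive differences are the `yᵢ`. -/
def negPartialSum (y : Fin n → V) (i : Fin n) : V := -∑ j ∈ Finset.Iio i, y j

theorem negPartialSum_finRotate {y : Fin n → V} (hy : ∑ i, y i = 0) (i : Fin n) :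
    negPartialSum y (finRotate n i) = negPartialSum y i - y i := by
  obtain _ | n := n
  · exact i.elim0
  · induction i using Fin.lastCases with
    | last =>
      have h : (Finset.univ : Finset (Fin (n + 1)))
          = insert (Fin.last n) (Finset.Iio (Fin.last n)) := by
        ext j
        simpa only [Finset.mem_univ, Finset.mem_insert, Finset.mem_Iio, true_iff] using
          (Fin.le_last j).eq_or_lt
      rw [h, Finset.sum_insert (by simp)] at hy
      have hy' : ∑ j ∈ Finset.Iio (Fin.last n), y j + y (Fin.last n) = 0 := by rw [add_comm, hy]
      have h0 : Finset.Iio (0 : Fin (n + 1)) = ∅ := by ext; simp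
      rw [finRotate_last, negPartialSum, negPartialSum, h0, Finset.sum_empty, ← neg_add', hy']
    | cast i =>
      have h : Finset.Iio i.succ = insert i.castSucc (Finset.Iio i.castSucc) := by
        ext j
        simp only [Finset.mem_Iio, Finset.mem_insert, Fin.lt_def, Fin.ext_iff, Fin.val_succ,
          Fin.val_castSucc]
        omega
      rw [finRotate_apply, Fin.coeSucc_eq_succ, negPartialSum, negPartialSum, h,
        Finset.sum_insert (by simp), neg_add_rev, sub_eq_add_neg]

variable (q) in
/-- The arc that contains the left (`false`) or right (`true`) edge on level `k` of column `i`. -/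
def arc (i : Fin n) (k : Fin ((q i).natAbs + 1)) (b : Bool) : (pretzel q).Arc :=
  Quot.mk _ ((⟨i, k⟩, b) : Edge q)

theorem exists_arc_eq (a : (pretzel q).Arc) : ∃ i k b, arc q i k b = a := by
  obtain ⟨⟨⟨i, k⟩, b⟩⟩ := a
  exact ⟨i, k, b, rfl⟩

theorem arc_cap (i : Fin n) : arc q i 0 true = arc q (finRotate n i) 0 false :=
  Quot.sound (LinkDiagram.ArcStep.joint (D := pretzel q) (false, i))

theorem arc_cup (i : Fin n) :
    arc q i (Fin.last _) true = arc q (finRotate n i) (Fin.last _) false :=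
  Quot.sound (LinkDiagram.ArcStep.joint (D := pretzel q) (true, i))

theorem sign_of_crossing (c : Crossing q) : (q c.1).sign = if 0 < q c.1 then 1 else -1 := by
  split_ifs with h
  · exact Int.sign_eq_one_of_pos h
  · have := c.2.isLt
    exact Int.sign_eq_neg_one_of_neg (by omega)

theorem arcAt_eq (c : Crossing q) :
    ((pretzel q).arcAt c 0, (pretzel q).arcAt c 1, (pretzel q).arcAt c 2, (pretzel q).arcAt c 3) =
      if 0 < q c.1 then
        (arc q c.1 c.2.succ false, arc q c.1 c.2.succ true,
          arc q c.1 c.2.castSucc true, arc q c.1 c.2.castSucc false)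
      else
        (arc q c.1 c.2.castSucc false, arc q c.1 c.2.succ false,
          arc q c.1 c.2.succ true, arc q c.1 c.2.castSucc true) := by
  split_ifs with h <;> simp [LinkDiagram.arcAt, pretzel, cross, corner, arc, h]

theorem arcAt_one_eq_arcAt_three (c : Crossing q) :
    (pretzel q).arcAt c 1 = (pretzel q).arcAt c 3 :=
  Quot.sound (LinkDiagram.ArcStep.over (D := pretzel q) c)

/-- The difference of the colours on the left and on the right of a level. -/
def gap (col : (pretzel q).Arc → V) (i : Fin n) (k : Fin ((q i).natAbs + 1)) : V :=
  col (arc q i k false) - col (arc q i k true)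

/-- The colouring relation at a crossing says that the gap does not change there. -/
theorem sign_smul_defect (col : (pretzel q).Arc → V) (c : Crossing q) :
    (q c.1).sign • LinkDiagram.defect col c = gap col c.1 c.2.castSucc - gap col c.1 c.2.succ := by
  have h := arcAt_eq c
  have h' := arcAt_one_eq_arcAt_three c
  have hdef : LinkDiagram.defect col c = (2 : ℤ) • col ((pretzel q).arcAt c 1)
      - col ((pretzel q).arcAt c 0) - col ((pretzel q).arcAt c 2) := rfl
  rw [sign_of_crossing, hdef, gap, gap, two_smul]
  split_ifs at h ⊢ <;> simp only [Prod.mk.injEq] at h <;> obtain ⟨h0, h1, h2, h3⟩ := h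
  · nth_rewrite 1 [h']
    rw [h0, h1, h2, h3]
    abel
  · nth_rewrite 1 [h']
    rw [h0, h1, h2, h3]
    abel

/-- The colouring relations are dependent: the sum telescopes in each column to the
gaps at its top and bottom, and these add up to zero around the diagram. -/
theorem sum_sign_smul_defect (col : (pretzel q).Arc → V) :
    ∑ c : Crossing q, (q c.1).sign • LinkDiagram.defect (D := pretzel q) col c = 0 := by
  have htel : ∀ i, ∑ k : Fin (q i).natAbs, (gap col i k.castSucc - gap col i k.succ)
      = gap col i 0 - gap col i (Fin.last _) := by
    intro i
    rw [Finset.sum_sub_distrib, sub_eq_sub_iff_add_eq_add]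
    exact (Fin.sum_univ_castSucc (gap col i)).symm.trans (Fin.sum_univ_succ (gap col i))
  have hcyc : ∀ g : Fin n → V, ∑ i, (g i - g (finRotate n i)) = 0 := by
    intro g
    rw [Finset.sum_sub_distrib, Equiv.sum_comp (finRotate n) g, sub_self]
  simp only [sign_smul_defect, Fintype.sum_sigma, htel,
    Finset.sum_sub_distrib (f := fun i => gap col i 0)]
  simp only [gap, arc_cap, arc_cup]
  rw [hcyc fun i => col (arc q i 0 false), hcyc fun i => col (arc q i (Fin.last _) false), sub_self]

/-- The relations at all crossings but one imply the last one. -/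
theorem defect_eq_zero_of_subsingleton {col : (pretzel q).Arc → V} {S : Set (Crossing q)}
    (hS : Sᶜ.Subsingleton) (h : ∀ c ∈ S, LinkDiagram.defect (D := pretzel q) col c = 0)
    (c : Crossing q) : LinkDiagram.defect (D := pretzel q) col c = 0 := by
  by_cases hc : c ∈ S
  · exact h c hc
  have hsum := sum_sign_smul_defect col
  rw [Fintype.sum_eq_single c fun c' hc' => by
    rw [h c' (by_contra fun h' => hc' (hS h' hc)), smul_zero], sign_of_crossing] at hsum
  split_ifs at hsum <;> simpa using hsum

theorem gap_eq {col : (pretzel q).Arc → V}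
    (h : ∀ c : Crossing q, LinkDiagram.defect (D := pretzel q) col c = 0) (i : Fin n)
    (k : Fin ((q i).natAbs + 1)) : gap col i k = gap col i 0 := by
  induction k using Fin.induction with
  | zero => rfl
  | succ k ih =>
    have := sign_smul_defect col ⟨i, k⟩
    rw [h, smul_zero] at this
    rw [← ih]
    exact (sub_eq_zero.1 this.symm).symm

/-- In a column all colours are determined by those at the top. -/
theorem col_arc_eq {col : (pretzel q).Arc → V}
    (h : ∀ c : Crossing q, LinkDiagram.defect (D := pretzel q) col c = 0) (i : Fin n)
    (k : Fin ((q i).natAbs + 1)) (b : Bool) :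
    col (arc q i k b) = col (arc q i 0 b) + ((q i).sign * (k : ℕ)) • gap col i 0 := by
  suffices hR : ∀ k, col (arc q i k true)
      = col (arc q i 0 true) + ((q i).sign * (k : ℕ)) • gap col i 0 by
    cases b
    · have h1 : col (arc q i k false) = gap col i k + col (arc q i k true) := by simp [gap]
      have h2 : col (arc q i 0 false) = gap col i 0 + col (arc q i 0 true) := by simp [gap]
      rw [h1, h2, gap_eq h, hR, add_assoc]
    · exact hR k
  intro k
  induction k using Fin.induction with
  | zero => simp
  | succ k ih =>
    have hstep : col (arc q i k.succ true) = col (arc q i k.castSucc true)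
        + (q i).sign • gap col i 0 := by
      have ha := arcAt_eq ⟨i, k⟩
      have h13 := arcAt_one_eq_arcAt_three ⟨i, k⟩
      have hs := sign_of_crossing ⟨i, k⟩
      have hg := gap_eq h i k.castSucc
      have hg' := gap_eq h i k.succ
      dsimp only at ha hs
      rw [hs]
      split_ifs at ha ⊢ <;> simp only [Prod.mk.injEq] at ha <;> obtain ⟨h0, h1, h2, h3⟩ := ha
      · rw [← hg, gap, ← h1, h13, h3, one_smul]
        abel
      · rw [← hg', gap, ← h1, h13, h3, neg_smul, one_smul]
        abel
    rw [hstep, ih, add_assoc, ← add_smul]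
    congr 2
    simp [mul_add]

/-- The colouring with gaps `y i`, starting with `0` on the top left of the first column. The
hypotheses on `y` make it consistent along the caps and along the cups. -/
def standardColoring (y : Fin n → V) (hy : ∑ i, y i = 0)
    (hq : ∀ i, q (finRotate n i) • y (finRotate n i) = q i • y i) : (pretzel q).Arc → V :=
  Quot.lift (fun e : Edge q => negPartialSum y (if e.2 then finRotate n e.1.1 else e.1.1)
      + ((q e.1.1).sign * (e.1.2 : ℕ)) • y e.1.1) <| by
    rintro _ _ (c | ⟨_ | _, i⟩)
    · obtain ⟨i, k⟩ := c
      have hs := sign_of_crossing ⟨i, k⟩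
      dsimp only at hs
      by_cases h : 0 < q i
      · have h1 : (pretzel q).cross ⟨i, k⟩ 1 = ((⟨i, k.succ⟩, true), false) := by
          simp [pretzel, cross, corner, h]
        have h3 : (pretzel q).cross ⟨i, k⟩ 3 = ((⟨i, k.castSucc⟩, false), true) := by
          simp [pretzel, cross, corner, h]
        rw [h1, h3]
        simp [hs, h, negPartialSum_finRotate hy, add_smul, -finRotate_apply]
      · have h1 : (pretzel q).cross ⟨i, k⟩ 1 = ((⟨i, k.succ⟩, false), false) := by
          simp [pretzel, cross, corner, h]
        have h3 : (pretzel q).cross ⟨i, k⟩ 3 = ((⟨i, k.castSucc⟩, true), true) := by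
          simp [pretzel, cross, corner, h]
        rw [h1, h3]
        simp [hs, h, negPartialSum_finRotate hy, add_smul, -finRotate_apply]
        abel
    · simp [pretzel, joint]
    · simp only [pretzel, joint]
      have hs : ∀ i, (q i).sign * |q i| = q i := fun i => Int.sign_mul_abs _
      simp [hs, hq, -finRotate_apply]

theorem standardColoring_arc (y : Fin n → V) (hy : ∑ i, y i = 0)
    (hq : ∀ i, q (finRotate n i) • y (finRotate n i) = q i • y i) (i : Fin n)
    (k : Fin ((q i).natAbs + 1)) (b : Bool) :
    standardColoring y hy hq (arc q i k b) = negPartialSum y (if b then finRotate n i else i)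
      + ((q i).sign * (k : ℕ)) • y i := rfl

theorem gap_standardColoring (y : Fin n → V) (hy : ∑ i, y i = 0)
    (hq : ∀ i, q (finRotate n i) • y (finRotate n i) = q i • y i) (i : Fin n)
    (k : Fin ((q i).natAbs + 1)) : gap (standardColoring y hy hq) i k = y i := by
  simp [gap, standardColoring_arc, negPartialSum_finRotate hy, -finRotate_apply]

theorem defect_standardColoring (y : Fin n → V) (hy : ∑ i, y i = 0)
    (hq : ∀ i, q (finRotate n i) • y (finRotate n i) = q i • y i) (c : Crossing q) :
    LinkDiagram.defect (standardColoring y hy hq) c = 0 := by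
  have h := sign_smul_defect (standardColoring y hy hq) c
  rw [gap_standardColoring, gap_standardColoring, sub_self, sign_of_crossing] at h
  split_ifs at h <;> simpa using h

theorem sum_gap_zero (col : (pretzel q).Arc → V) : ∑ i, gap col i 0 = 0 := by
  simp only [gap, arc_cap, Finset.sum_sub_distrib]
  rw [Equiv.sum_comp (finRotate n) fun i => col (arc q i 0 false), sub_self]

theorem smul_gap_finRotate {col : (pretzel q).Arc → V}
    (h : ∀ c : Crossing q, LinkDiagram.defect (D := pretzel q) col c = 0) (i : Fin n) :
    q (finRotate n i) • gap col (finRotate n i) 0 = q i • gap col i 0 := by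
  have hb : ∀ i b, q i • gap col i 0 = col (arc q i (Fin.last _) b) - col (arc q i 0 b) := by
    intro i b
    rw [col_arc_eq h i (Fin.last _) b, Fin.val_last, Int.sign_mul_natAbs, add_sub_cancel_left]
  rw [hb i true, hb _ false, arc_cap, arc_cup]

/-- Every colouring is a standard one up to a constant. -/
theorem col_eq_standardColoring {col : (pretzel q).Arc → V}
    (h : ∀ c : Crossing q, LinkDiagram.defect (D := pretzel q) col c = 0) (i₀ : Fin n)
    (a : (pretzel q).Arc) :
    col a = standardColoring (fun i => gap col i 0) (sum_gap_zero col) (smul_gap_finRotate h) a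
      + (col (arc q i₀ 0 false) - negPartialSum (fun i => gap col i 0) i₀) := by
  have hconst := fun i => apply_eq_of_finRotate
    (g := fun i => col (arc q i 0 false) - negPartialSum (fun i => gap col i 0) i) (fun i => by
      rw [negPartialSum_finRotate (sum_gap_zero col), ← arc_cap, gap]
      abel) i₀ i
  obtain ⟨i, k, b, rfl⟩ := exists_arc_eq a
  rw [standardColoring_arc, col_arc_eq h]
  cases b
  · have := hconst i
    rw [this, if_neg (by simp)]
    abel
  · have := hconst (finRotate n i)
    rw [this, if_pos rfl, ← arc_cap]
    abel

end Pretzel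

/-! ### The colouring group of a pretzel knot -/

namespace Pretzel

variable {n : ℕ} {q : Fin n → ℤ} {V W : Type*} [AddCommGroup V] [AddCommGroup W]

theorem map_standardColoring (φ : V →ₗ[ℤ] W) {y : Fin n → V} {y' : Fin n → W}
    (h : ∀ i, φ (y i) = y' i) (hy : ∑ i, y i = 0)
    (hq : ∀ i, q (finRotate n i) • y (finRotate n i) = q i • y i) (hy' : ∑ i, y' i = 0)
    (hq' : ∀ i, q (finRotate n i) • y' (finRotate n i) = q i • y' i) (a : (pretzel q).Arc) :
    φ (standardColoring y hy hq a) = standardColoring y' hy' hq' a := by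
  obtain ⟨i, k, b, rfl⟩ := exists_arc_eq a
  simp only [standardColoring_arc, negPartialSum, map_add, map_neg, map_sum, map_smul, h]

theorem defect_sub_const (col : (pretzel q).Arc → V) (v : V) (c : Crossing q) :
    LinkDiagram.defect (D := pretzel q) (fun a => col a - v) c
      = LinkDiagram.defect (D := pretzel q) col c := by
  simp only [LinkDiagram.defect, two_smul]
  abel

variable (q) in
/-- The relations `q i • y i = l` and `∑ i, y i = 0` between the gaps `y i` of a colouring and the
common difference `l` of the colours at the top and at the bottom of a column. -/
def gapMatrix : Matrix (Fin n ⊕ Unit) (Fin n ⊕ Unit) ℤ :=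
  Matrix.fromBlocks (Matrix.diagonal q) (Matrix.of fun _ _ => -1) (Matrix.of fun _ _ => 1) 0

theorem sum_gapMatrix_inl_smul (v : Fin n ⊕ Unit → V) (i : Fin n) :
    ∑ j, gapMatrix q (Sum.inl i) j • v j = q i • v (Sum.inl i) - v (Sum.inr ()) := by
  simp [gapMatrix, Matrix.diagonal_apply, ite_smul, sub_eq_add_neg]

theorem sum_gapMatrix_inr_smul (v : Fin n ⊕ Unit → V) :
    ∑ j, gapMatrix q (Sum.inr ()) j • v j = ∑ i, v (Sum.inl i) := by
  simp [gapMatrix]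

open Matrix.RowQuotient in
/-- A minor of the colouring matrix presents the group of the universal colouring that vanishes on
one arc. Colourings being standard, this group is generated by the gaps. -/
theorem nonempty_rowQuotient_equiv {ι : Type*} [Fintype ι] [DecidableEq ι] (i₀ : Fin n)
    {r : ι → Crossing q} (hr : (Set.range r)ᶜ.Subsingleton) {s : ι → (pretzel q).Arc}
    (hs : Function.Injective s) {a₀ : (pretzel q).Arc} (ha₀ : ∀ a, a ∉ Set.range s ↔ a = a₀) :
    Nonempty (Matrix.RowQuotient ((LinkDiagram.coloringMatrix (pretzel q)).submatrix r s)
      ≃ₗ[ℤ] (gapMatrix q).RowQuotient) := by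
  have : Finite (pretzel q).Edge := inferInstanceAs (Finite (Edge q))
  set N := (LinkDiagram.coloringMatrix (pretzel q)).submatrix r s
  -- the universal colouring of the minor
  let col : (pretzel q).Arc → N.RowQuotient := Function.extend s (gen N) 0
  have hcol : ∀ j, col (s j) = gen N j := hs.extend_apply _ _
  have hcol' : ∀ a ∉ Set.range s, col a = 0 := fun a ha => Function.extend_apply' _ _ _ ha
  have hcol₀ : col a₀ = 0 := hcol' _ ((ha₀ _).2 rfl)
  have hdef : ∀ c : Crossing q, LinkDiagram.defect (D := pretzel q) col c = 0 := by
    refine defect_eq_zero_of_subsingleton hr ?_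
    rintro _ ⟨i, rfl⟩
    rw [← LinkDiagram.sum_coloringMatrix_smul hs hcol' (r i)]
    simp only [hcol]
    exact sum_row_smul_gen N i
  -- the colouring with values in the group of gaps
  let y : Fin n → (gapMatrix q).RowQuotient := fun i => gen _ (Sum.inl i)
  have hy : ∑ i, y i = 0 :=
    (sum_gapMatrix_inr_smul _).symm.trans (sum_row_smul_gen (gapMatrix q) (Sum.inr ()))
  have hyq : ∀ i, q i • y i = gen _ (Sum.inr ()) := fun i =>
    sub_eq_zero.1 <|
      (sum_gapMatrix_inl_smul _ i).symm.trans (sum_row_smul_gen (gapMatrix q) (Sum.inl i))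
  have hq : ∀ i, q (finRotate n i) • y (finRotate n i) = q i • y i := fun i => by rw [hyq, hyq]
  let std := standardColoring y hy hq
  let h : N.RowQuotient →ₗ[ℤ] (gapMatrix q).RowQuotient :=
    lift (fun j => std (s j) - std a₀) fun i => by
      refine (LinkDiagram.sum_coloringMatrix_smul hs (col := fun a => std a - std a₀) ?_ (r i)).trans
        ?_
      · intro a ha
        rw [(ha₀ a).1 ha, sub_self]
      · exact (defect_sub_const _ _ _).trans (defect_standardColoring y hy hq _)
  have hh : ∀ a, h (col a) = std a - std a₀ := by
    intro a
    by_cases ha : a ∈ Set.range s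
    · obtain ⟨j, rfl⟩ := ha
      rw [hcol]
      exact lift_gen _ _ _
    · rw [hcol' a ha, map_zero, (ha₀ a).1 ha, sub_self]
  have hgapq : ∀ i, q i • gap col i 0 = q i₀ • gap col i₀ 0 := fun i =>
    apply_eq_of_finRotate (g := fun i => q i • gap col i 0) (smul_gap_finRotate hdef) i i₀
  let g : (gapMatrix q).RowQuotient →ₗ[ℤ] N.RowQuotient :=
    lift (Sum.elim (fun i => gap col i 0) fun _ => q i₀ • gap col i₀ 0) <| by
      rintro (i | _)
      · exact (sum_gapMatrix_inl_smul _ i).trans (sub_eq_zero.2 (hgapq i))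
      · exact (sum_gapMatrix_inr_smul _).trans (sum_gap_zero col)
  have hg : ∀ i, g (y i) = gap col i 0 := fun i => lift_gen _ _ _
  have hgstd : ∀ a b, g (std a) - g (std b) = col a - col b := by
    intro a b
    rw [col_eq_standardColoring hdef i₀ a, col_eq_standardColoring hdef i₀ b,
      add_sub_add_right_eq_sub]
    congr 1 <;> exact map_standardColoring g hg _ _ _ _ _
  have hhgap : ∀ i, h (gap col i 0) = y i := fun i => by
    rw [gap, map_sub, hh, hh, sub_sub_sub_cancel_right]
    exact gap_standardColoring y hy hq i 0
  refine ⟨LinearEquiv.ofLinearMap h g (hom_ext ?_) (hom_ext fun j => ?_)⟩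
  · rintro (i | _)
    · exact (congrArg h (hg i)).trans (hhgap i)
    · have : g (gen _ (Sum.inr ())) = q i₀ • gap col i₀ 0 := lift_gen _ _ _
      rw [LinearMap.comp_apply, this, map_smul, hhgap, hyq, LinearMap.id_apply]
  · rw [LinearMap.comp_apply, LinearMap.id_apply, ← hcol, hh, map_sub, hgstd, hcol₀, sub_zero]

theorem abs_det_submatrix {ι : Type*} [Fintype ι] [DecidableEq ι] (i₀ : Fin n)
    {r : ι → Crossing q} (hr : (Set.range r)ᶜ.Subsingleton) {s : ι → (pretzel q).Arc}
    (hs : Function.Injective s) {a₀ : (pretzel q).Arc} (ha₀ : ∀ a, a ∉ Set.range s ↔ a = a₀) :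
    |((LinkDiagram.coloringMatrix (pretzel q)).submatrix r s).det|
      = |∑ i, ∏ j ∈ Finset.univ.erase i, q j| := by
  obtain ⟨e⟩ := nonempty_rowQuotient_equiv i₀ hr hs ha₀
  have h := Nat.card_congr e.toEquiv
  rw [Matrix.RowQuotient.card_eq_natAbs_det, Matrix.RowQuotient.card_eq_natAbs_det, gapMatrix,
    Matrix.det_bordered_diagonal] at h
  rw [Int.abs_eq_natAbs, Int.abs_eq_natAbs, h]

theorem isDeterminant_iff (hK : (pretzel q).IsKnot) (d : ℤ) :
    (pretzel q).IsDeterminant d ↔ d = |∑ i, ∏ j ∈ Finset.univ.erase i, q j| := by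
  classical
  have : Finite (pretzel q).Edge := inferInstanceAs (Finite (Edge q))
  have : Fintype (pretzel q).Crossing := inferInstanceAs (Fintype (Crossing q))
  have : Finite (pretzel q).Joint := inferInstanceAs (Finite (Joint n))
  have := Fintype.ofFinite (pretzel q).Arc
  have h1 := (pretzel q).card_crossing_le_card_arc
  have h2 := LinkDiagram.IsKnot.card_arc_le _ hK
  have hne : Nonempty (pretzel q).Arc := by
    have hK' : Nat.card (pretzel q).Component = 1 := hK
    obtain ⟨⟨e⟩⟩ := (Nat.card_pos_iff.1 (hK'.symm ▸ Nat.one_pos)).1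
    exact ⟨Quot.mk _ e⟩
  obtain ⟨i₀, -⟩ := exists_arc_eq hne.some
  have h3 : 0 < Nat.card (pretzel q).Arc := Nat.card_pos
  rw [LinkDiagram.isDeterminant_iff]
  have key : ∀ (r : Fin (Nat.card (pretzel q).Arc - 1) ↪ (pretzel q).Crossing)
      (s : Fin (Nat.card (pretzel q).Arc - 1) ↪ (pretzel q).Arc),
      |((LinkDiagram.coloringMatrix (pretzel q)).submatrix r s).det|
        = |∑ i, ∏ j ∈ Finset.univ.erase i, q j| := by
    intro r s
    -- Just one arc is left out, and at most one crossing.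
    have hs : (Finset.univ.map s)ᶜ.card = 1 := by
      rw [Finset.card_compl, Finset.card_map, Finset.card_univ, Fintype.card_fin,
        ← Nat.card_eq_fintype_card]
      omega
    obtain ⟨a₀, ha₀⟩ := Finset.card_eq_one.1 hs
    have hr : (Finset.univ.map r)ᶜ.card ≤ 1 := by
      rw [Finset.card_compl, Finset.card_map, Finset.card_univ, Fintype.card_fin,
        ← Nat.card_eq_fintype_card]
      omega
    refine abs_det_submatrix i₀ (a₀ := a₀) ?_ s.injective fun a => ?_
    · intro c hc c' hc'
      refine Finset.card_le_one.1 hr c ?_ c' ?_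
      · exact Finset.mem_compl.2 fun h =>
          hc ((Finset.mem_map.1 h).imp fun _ h => h.2)
      · exact Finset.mem_compl.2 fun h =>
          hc' ((Finset.mem_map.1 h).imp fun _ h => h.2)
    · simpa using Finset.ext_iff.1 ha₀ a
  constructor
  · rintro ⟨r, s, rfl⟩
    exact key r s
  · rintro rfl
    have hr : Nonempty (Fin (Nat.card (pretzel q).Arc - 1) ↪ (pretzel q).Crossing) :=
      Function.Embedding.nonempty_of_card_le (by
        rw [Fintype.card_fin, ← Nat.card_eq_fintype_card]
        omega)
    have hs : Nonempty (Fin (Nat.card (pretzel q).Arc - 1) ↪ (pretzel q).Arc) :=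
      Function.Embedding.nonempty_of_card_le (by
        rw [Fintype.card_fin, ← Nat.card_eq_fintype_card]
        omega)
    obtain ⟨⟨r⟩, ⟨s⟩⟩ := And.intro hr hs
    exact ⟨r, s, (key r s).symm⟩

end Pretzel

/-! ### The elementary symmetric polynomial of degree `n - 1` -/

theorem esymm_card_sub_one {n : ℕ} (hn : n ≠ 0) {R : Type*} [CommSemiring R] (q : Fin n → R) :
    ((Finset.univ : Finset (Fin n)).val.map q).esymm (n - 1)
      = ∑ i, ∏ j ∈ Finset.univ.erase i, q j := by
  rw [Finset.esymm_map_val]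
  symm
  refine Finset.sum_bij (fun i _ => Finset.univ.erase i) ?_ ?_ ?_ fun _ _ => rfl
  · intro i _
    simp [Finset.mem_powersetCard, Finset.card_erase_of_mem]
  · intro i _ j _ h
    exact Finset.erase_injOn _ (Finset.mem_coe.2 (Finset.mem_univ _))
      (Finset.mem_coe.2 (Finset.mem_univ _)) h
  · intro t ht
    have hc : tᶜ.card = 1 := by
      rw [Finset.card_compl, (Finset.mem_powersetCard.1 ht).2, Fintype.card_fin]
      omega
    obtain ⟨i, hi⟩ := Finset.card_eq_one.1 hc
    refine ⟨i, Finset.mem_univ _, ?_⟩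
    rw [← compl_compl t, hi, Finset.compl_singleton]

theorem prod_mul_sum_one_div {ι K : Type*} [Fintype ι] [DecidableEq ι] [Field K] {q : ι → K}
    (hq : ∀ i, q i ≠ 0) :
    (∏ i, q i) * ∑ i, 1 / q i = ∑ i, ∏ j ∈ Finset.univ.erase i, q j := by
  rw [Finset.mul_sum]
  refine Finset.sum_congr rfl fun i hi => ?_
  rw [← Finset.mul_prod_erase _ _ hi, mul_one_div, mul_div_cancel_left₀ _ (hq i)]

/-! ### The determinant of a pretzel knot -/

theorem mainTheorem2 {n : ℕ} (q : Fin n → ℤ) (hK : (pretzel q).IsKnot) :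
    (∀ d : ℤ, (pretzel q).IsDeterminant d ↔
      d = |((Finset.univ : Finset (Fin n)).val.map q).esymm (n - 1)|) ∧
    ((∀ i, q i ≠ 0) → ∀ d : ℤ, (pretzel q).IsDeterminant d ↔
      (d : ℚ) = |(∏ i, (q i : ℚ)) * ∑ i, 1 / (q i : ℚ)|) := by
  refine ⟨fun d => ?_, fun hq d => ?_⟩
  · have hn : n ≠ 0 := by
      rintro rfl
      have hK' : Nat.card (pretzel q).Component = 1 := hK
      obtain ⟨⟨⟨⟨i, -⟩, -⟩⟩⟩ := (Nat.card_pos_iff.1 (hK'.symm ▸ Nat.one_pos)).1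
      exact i.elim0
    rw [Pretzel.isDeterminant_iff hK, esymm_card_sub_one hn]
  · rw [Pretzel.isDeterminant_iff hK,
      prod_mul_sum_one_div fun i => Int.cast_ne_zero.2 (hq i)]
    exact_mod_cast Iff.rfl
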